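/- Positive point masses $m_1,\dots,m_N$ at pairwise distinct positions $q_1,\dots,q_N\in\mathbb{R}^d$ form a \emph{central configuration} if there is $\lambda\in\mathbb{R}$ such that $$-\lambda\,(q_i-q_0)=\sum_{j\neq i} m_j\,\frac{q_j-q_i}{|q_j-q_i|^3},\qquad i=1,\dots,N,\qquad\text{where } q_0=\frac{m_1q_1+\cdots+m_Nq_N}{m_1+\cdots+m_N}.$$ \textbf{Theorem.} Let $0<t<1$, let $q_1,\dots,q_6\in\mathbb{R}^3$ be the vertices of a regular octahedron, and let $q_7,\dots,q_{12}$ be the vertices of the concentric octahedron obtained from it by the homothety of ratio $t$ about its center, where $q_{6+j}$ is the image of $q_j$ for $j=1,\dots,6$. If positive masses $m_1,\dots,m_{12}$ at the positions $q_1,\dots,q_{12}$ form a central configuration, then the masses in each octahedron are equal: $m_1=m_2=\cdots=m_6$ and $m_7=m_8=\cdots=m_{12}$. -/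

import Mathlib

/-- Point masses `m i` at positions `q i` in `ℝ^d` form a central configuration for the Newtonian
`N`-body problem: for some real `lam`, every body's gravitational acceleration equals
`-lam (q i - q₀)`, where `q₀` is the center of mass. -/
def IsCentralConfiguration {ι : Type*} [Fintype ι] [DecidableEq ι] {d : ℕ}
    (m : ι → ℝ) (q : ι → EuclideanSpace ℝ (Fin d)) : Prop :=
  ∃ lam : ℝ, ∀ i : ι,
    (-lam) • (q i - Finset.univ.centerMass m q) =
      ∑ j ∈ Finset.univ.erase i, (m j / ‖q j - q i‖ ^ 3) • (q j - q i)

/-- The vertices of the standard regular octahedron in `ℝ³`, centered at the origin. -/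
noncomputable def octahedronVertex : Fin 6 → EuclideanSpace ℝ (Fin 3) :=
  ![!₂[1, 0, 0], !₂[-1, 0, 0], !₂[0, 1, 0], !₂[0, -1, 0], !₂[0, 0, 1], !₂[0, 0, -1]]

/-- The twelve points `q` are the vertices of two nested regular octahedra with edge ratio `t`:
up to a rigid motion `g` of `ℝ³`, `q (inl j)` is the `j`-th vertex of the octahedron of
circumradius `r` (the outer one), and `q (inr j)` is the image of `q (inl j)` under the homothety
of ratio `t` about the common center. -/
def IsNestedOctahedra (t : ℝ) (q : Fin 6 ⊕ Fin 6 → EuclideanSpace ℝ (Fin 3)) : Prop :=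
  0 < t ∧ t < 1 ∧
    ∃ (g : EuclideanSpace ℝ (Fin 3) ≃ᵃⁱ[ℝ] EuclideanSpace ℝ (Fin 3)) (r : ℝ), 0 < r ∧
      ∀ j : Fin 6, q (Sum.inl j) = g (r • octahedronVertex j) ∧
        q (Sum.inr j) = g ((t * r) • octahedronVertex j)

/-! After a similarity the shells are the vertices e and t·e, and the equations are linear in the
masses. Only combinations free of the multiplier and of the center are used, so the center's formula
plays no role. Two kinds suffice: adding the axial components at two antipodes and subtracting twice
that at a vertex of another axis leaves only antipodal mass differences; subtracting them and
comparing two axes leaves only differences of axis sums. Each kind gives 2×2 systems whose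
coefficients are those of `nestedOctahedra_coeff_pos`, with signs making the determinant nonzero
(`eq_zero_of_opposite_slopes`). -/

open Finset in
/-- A central configuration satisfies the coordinate-free equations with some center `w`, and these
are inherited by the configuration before a similarity was applied to it. -/
theorem IsCentralConfiguration.exists_of_similarity {ι : Type*} [Fintype ι] [DecidableEq ι] {d : ℕ}
    {m : ι → ℝ} {q p : ι → EuclideanSpace ℝ (Fin d)}
    (g : EuclideanSpace ℝ (Fin d) ≃ᵃⁱ[ℝ] EuclideanSpace ℝ (Fin d)) {r : ℝ} (hr : 0 < r)
    (hq : ∀ i, q i = g (r • p i)) (hc : IsCentralConfiguration m q) :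
    ∃ (lam : ℝ) (w : EuclideanSpace ℝ (Fin d)), ∀ i,
      (-lam) • (p i - w) = ∑ j, (m j / ‖p j - p i‖ ^ 3) • (p j - p i) := by
  obtain ⟨lam, h⟩ := hc
  refine ⟨lam * r ^ 3, r⁻¹ • g.symm (univ.centerMass m q), fun i => ?_⟩
  have hsub : ∀ x y, g x - g y = g.linearIsometryEquiv (x - y) := fun x y => by
    rw [← vsub_eq_sub, ← vsub_eq_sub, ← AffineIsometryEquiv.map_vsub]
  have hdiff : ∀ j k, q j - q k = g.linearIsometryEquiv (r • (p j - p k)) := fun j k => by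
    rw [hq, hq, hsub, smul_sub]
  have hcenter : q i - univ.centerMass m q =
      g.linearIsometryEquiv (r • (p i - r⁻¹ • g.symm (univ.centerMass m q))) := by
    conv_lhs => rw [hq, ← g.apply_symm_apply (univ.centerMass m q), hsub]
    rw [smul_sub, smul_inv_smul₀ hr.ne']
  have hi := h i
  rw [hcenter, ← map_smul, sum_erase univ (by simp)] at hi
  simp only [hdiff, ← map_smul, ← map_sum, LinearIsometryEquiv.norm_map, norm_smul,
    Real.norm_of_nonneg hr.le] at hi
  -- Forces scale by `r⁻²` and displacements by `r`, whence the multiplier `lam * r ^ 3`.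
  have hi := congrArg (fun x => r ^ 2 • x) (g.linearIsometryEquiv.injective hi)
  simp only [smul_sum, smul_smul] at hi
  convert hi using 2 with j
  · ring
  · congr 1
    rcases eq_or_ne (‖p j - p i‖) 0 with h0 | h0
    · simp [h0]
    · field_simp

-- Vertices `2k` and `2k + 1` are antipodal, so halving the index gives the axis; vertices on
-- different axes are orthogonal.
set_option maxHeartbeats 1000000 in
theorem norm_smul_octahedronVertex_sub_sq (a b : ℝ) (i j : Fin 6) :
    ‖a • octahedronVertex j - b • octahedronVertex i‖ ^ 2 =
      if j = i then (a - b) ^ 2 else if j.val / 2 = i.val / 2 then (a + b) ^ 2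
      else a ^ 2 + b ^ 2 := by
  rw [EuclideanSpace.real_norm_sq_eq, Fin.sum_univ_three]
  fin_cases i <;> fin_cases j <;> simp [octahedronVertex] <;> ring

/-- Distance between vertices of two concentric homothetic octahedra. -/
theorem norm_smul_octahedronVertex_sub (a b : ℝ) (i j : Fin 6) :
    ‖a • octahedronVertex j - b • octahedronVertex i‖ =
      if j = i then |a - b| else if j.val / 2 = i.val / 2 then |a + b| else √(a ^ 2 + b ^ 2) := by
  rw [← Real.sqrt_sq (norm_nonneg _), norm_smul_octahedronVertex_sub_sq]
  split_ifs <;> simp only [Real.sqrt_sq_eq_abs]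

/-- Two linear relations with coefficients of suitable signs have only the trivial solution. -/
theorem eq_zero_of_opposite_slopes {a b c d x y : ℝ} (ha : 0 < a) (hb : 0 < b) (hc : 0 < c)
    (hd : 0 < d) (h₁ : a * x + b * y = 0) (h₂ : c * x = d * y) : x = 0 ∧ y = 0 := by
  have hx : (a * d + b * c) * x = 0 := by linear_combination d * h₁ + b * h₂
  have hx0 : x = 0 := (mul_eq_zero.mp hx).resolve_left (by positivity)
  exact ⟨hx0, by simpa [hx0, hb.ne'] using h₁⟩

/-- Positivity of the coefficients in the equations for nested octahedra. -/
theorem nestedOctahedra_coeff_pos {t : ℝ} (ht : 0 < t) (ht1 : t < 1) :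
    0 < 2 / √2 ^ 3 - 1 / 4 ∧
    0 < 2 * t / √(1 + t ^ 2) ^ 3 + 1 / (1 - t) ^ 2 - 1 / (1 + t) ^ 2 ∧
    0 < 1 / (1 - t) ^ 2 + 1 / (1 + t) ^ 2 - 2 / √(1 + t ^ 2) ^ 3 ∧
    0 < 2 * t / (t * √2) ^ 3 - 1 / (4 * t ^ 2) := by
  have h2 : 0 < 2 / √2 ^ 3 - 1 / 4 := by
    have h : √2 ^ 3 < 2 ^ 3 := by
      gcongr
      rw [Real.sqrt_lt' two_pos]; norm_num
    rw [sub_pos, div_lt_div_iff₀ (by norm_num) (by positivity)]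
    linarith
  have hs : 0 < 1 - t := sub_pos.mpr ht1
  refine ⟨h2, ?_, ?_, ?_⟩
  · have h : 1 / (1 + t) ^ 2 < 1 / (1 - t) ^ 2 := by
      gcongr; linarith
    have : 0 < 2 * t / √(1 + t ^ 2) ^ 3 := by positivity
    linarith
  -- The constant 2 separates the two sides: `2 / √(1 + t ^ 2) ^ 3 ≤ 2`, while the other two terms
  -- sum to more than 2.
  · have hu : 0 < 1 - t ^ 2 := by nlinarith
    have h : 2 / √(1 + t ^ 2) ^ 3 ≤ 2 := by
      apply div_le_self two_pos.le
      apply one_le_pow₀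
      rw [Real.one_le_sqrt]
      nlinarith
    have h' : 1 / (1 - t) ^ 2 + 1 / (1 + t) ^ 2 = 2 * (1 + t ^ 2) / (1 - t ^ 2) ^ 2 := by
      rw [show 1 - t ^ 2 = (1 - t) * (1 + t) by ring]
      field_simp
      ring
    have h'' : 2 < 2 * (1 + t ^ 2) / (1 - t ^ 2) ^ 2 := by
      rw [lt_div_iff₀ (by positivity)]
      have : (1 - t ^ 2) ^ 2 < 1 := by nlinarith [pow_pos ht 2]
      nlinarith [pow_pos ht 2]
    linarith
  · have : 2 * t / (t * √2) ^ 3 - 1 / (4 * t ^ 2) = (2 / √2 ^ 3 - 1 / 4) / t ^ 2 := by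
      field_simp
    rw [this]
    positivity

set_option maxHeartbeats 2000000 in
/-- The scaled equations for nested octahedra force the masses in each shell to be equal. The
difference of the masses at opposite vertices is compared first, then the sums for two axes. -/
theorem nestedOctahedra_masses_eq {t : ℝ} (ht : 0 < t) (ht1 : t < 1) {a b : Fin 6 → ℝ}
    {lam : ℝ} {w : Fin 3 → ℝ}
    (key : ∀ (s : ℝ) (i : Fin 6) (k : Fin 3), (s = 1 ∨ s = t) →
      -lam * (s * octahedronVertex i k - w k) =
      ∑ j, (a j / (if j = i then |1 - s| else if j.val / 2 = i.val / 2 then |1 + s|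
            else √(1 ^ 2 + s ^ 2)) ^ 3 * (octahedronVertex j k - s * octahedronVertex i k)
        + b j / (if j = i then |t - s| else if j.val / 2 = i.val / 2 then |t + s|
            else √(t ^ 2 + s ^ 2)) ^ 3 * (t * octahedronVertex j k - s * octahedronVertex i k))) :
    (∀ i, a i = a 0) ∧ ∀ i, b i = b 0 := by
  obtain ⟨h₁, h₂, h₃, h₄⟩ := nestedOctahedra_coeff_pos ht ht1
  have hs : 1 - t ≠ 0 := (sub_pos.mpr ht1).ne'
  have hs' : 1 + t ≠ 0 := by positivity
  have r₁ : |t - 1| = 1 - t := by rw [abs_of_neg (by linarith)]; ring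
  have r₂ : |1 - t| = 1 - t := abs_of_pos (by linarith)
  have r₃ : |t + 1| = 1 + t := by rw [abs_of_pos (by linarith)]; ring
  have r₄ : |1 + t| = 1 + t := abs_of_pos (by linarith)
  have r₅ : |t + t| = 2 * t := by rw [abs_of_pos (by linarith)]; ring
  have r₆ : |(1 : ℝ) + 1| = 2 := by norm_num
  have r₇ : √(t ^ 2 + 1) = √(1 + t ^ 2) := by rw [add_comm]
  have r₈ : √((1 : ℝ) + 1) = √2 := by norm_num
  have r₉ : √(t ^ 2 + t ^ 2) = t * √2 := by
    rw [← mul_two, Real.sqrt_mul (sq_nonneg t), Real.sqrt_sq ht.le]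
  have d₁ : 1 / (1 - t) ^ 2 = (1 - t) / (1 - t) ^ 3 := by field_simp
  have d₂ : 1 / (1 + t) ^ 2 = (1 + t) / (1 + t) ^ 3 := by field_simp
  have d₃ : 1 / (4 * t ^ 2) = 2 * t / (2 * t) ^ 3 := by field_simp; norm_num
  rw [d₁, d₂] at h₂ h₃
  rw [d₃] at h₄
  -- `o` is the outer shell, `n` the inner; the digits are the coordinate, then the vertex.
  have o00 := key 1 0 0 (Or.inl rfl)
  have o01 := key 1 1 0 (Or.inl rfl)
  have o02 := key 1 2 0 (Or.inl rfl)
  have n00 := key t 0 0 (Or.inr rfl)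
  have n01 := key t 1 0 (Or.inr rfl)
  have n02 := key t 2 0 (Or.inr rfl)
  have o12 := key 1 2 1 (Or.inl rfl)
  have o13 := key 1 3 1 (Or.inl rfl)
  have o14 := key 1 4 1 (Or.inl rfl)
  have n12 := key t 2 1 (Or.inr rfl)
  have n13 := key t 3 1 (Or.inr rfl)
  have n14 := key t 4 1 (Or.inr rfl)
  have o24 := key 1 4 2 (Or.inl rfl)
  have o25 := key 1 5 2 (Or.inl rfl)
  have o20 := key 1 0 2 (Or.inl rfl)
  have n24 := key t 4 2 (Or.inr rfl)
  have n25 := key t 5 2 (Or.inr rfl)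
  have n20 := key t 0 2 (Or.inr rfl)
  simp [Fin.sum_univ_six, octahedronVertex, r₁, r₂, r₃, r₄, r₅, r₆, r₇, r₈, r₉]
    at o00 o01 o02 n00 n01 n02 o12 o13 o14
      n12 n13 n14 o24 o25 o20 n24 n25 n20
  -- The weights 1, 1, -2 cancel `w`, and antipodal positions cancel `lam`.
  obtain ⟨A0, B0⟩ := eq_zero_of_opposite_slopes h₁ h₂ h₃ h₄
    (show _ * (a 0 - a 1) + _ * (b 0 - b 1) = 0 by
      linear_combination o00 + o01 - 2 * o02)
    (by linear_combination 2 * n02 - n00 - n01)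
  obtain ⟨A1, B1⟩ := eq_zero_of_opposite_slopes h₁ h₂ h₃ h₄
    (show _ * (a 2 - a 3) + _ * (b 2 - b 3) = 0 by
      linear_combination o12 + o13 - 2 * o14)
    (by linear_combination 2 * n14 - n12 - n13)
  obtain ⟨A2, B2⟩ := eq_zero_of_opposite_slopes h₁ h₂ h₃ h₄
    (show _ * (a 4 - a 5) + _ * (b 4 - b 5) = 0 by
      linear_combination o24 + o25 - 2 * o20)
    (by linear_combination 2 * n20 - n24 - n25)
  -- The antipodal difference cancels `w`, the difference of axes cancels `lam`. The same four
  -- coefficients return in other places: the inner shell now gives the sum relation, the outer the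
  -- proportionality.
  obtain ⟨S1, T1⟩ := eq_zero_of_opposite_slopes h₂ h₄ h₁ h₃
    (show _ * (a 2 + a 3 - a 0 - a 1) + _ * (b 2 + b 3 - b 0 - b 1) = 0 by
      linear_combination n00 - n01 - n12 + n13)
    (by linear_combination o00 - o01 - o12 + o13)
  obtain ⟨S2, T2⟩ := eq_zero_of_opposite_slopes h₂ h₄ h₁ h₃
    (show _ * (a 4 + a 5 - a 0 - a 1) + _ * (b 4 + b 5 - b 0 - b 1) = 0 by
      linear_combination n00 - n01 - n24 + n25)
    (by linear_combination o00 - o01 - o24 + o25)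
  constructor <;> intro i <;> fin_cases i <;>
    simp only [Fin.reduceFinMk, Fin.zero_eta, Fin.mk_one] <;> linarith

theorem mainTheorem5 (t : ℝ) (q : Fin 6 ⊕ Fin 6 → EuclideanSpace ℝ (Fin 3))
    (m : Fin 6 ⊕ Fin 6 → ℝ) (hq : IsNestedOctahedra t q) (hm : ∀ i, 0 < m i)
    (hc : IsCentralConfiguration m q) :
    (∀ i j : Fin 6, m (Sum.inl i) = m (Sum.inl j)) ∧
      (∀ i j : Fin 6, m (Sum.inr i) = m (Sum.inr j)) := by
  obtain ⟨ht, ht1, g, r, hr, hq⟩ := hq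
  obtain ⟨lam, w, h⟩ := hc.exists_of_similarity g hr
    (p := Sum.elim octahedronVertex fun j => t • octahedronVertex j) (by
      rintro (j | j)
      · exact (hq j).1
      · simpa [smul_smul, mul_comm] using (hq j).2)
  obtain ⟨ha, hb⟩ := nestedOctahedra_masses_eq ht ht1 (a := fun j => m (Sum.inl j))
    (b := fun j => m (Sum.inr j)) (lam := lam) (w := fun k => w k) (by
      intro s i k hs
      simp_rw [← norm_smul_octahedronVertex_sub, Finset.sum_add_distrib]
      rcases hs with rfl | rfl
      · simpa using congrArg (fun x => x k) (h (Sum.inl i))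
      · simpa using congrArg (fun x => x k) (h (Sum.inr i)))
  exact ⟨fun i j => (ha i).trans (ha j).symm, fun i j => (hb i).trans (hb j).symm⟩
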